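/- **Setting.** Let $\Sigma$ be a many-sorted first-order signature with constants, functions and relations and a designated foreground sort; all other sorts are background sorts. Sorts are interpreted by non-empty sets and equality is interpreted as identity. Fix a set $T$ of first-order sentences that do not involve the foreground sort (the background theory); "model" always means a model of $T$. Some relation symbols $R$ over the foreground sort have a recursive definition $R(\bar x) :=_{\mathrm{lfp}} \rho_R(\bar x)$, where $\rho_R$ is quantifier-free and contains the recursively defined relations only positively; $\mathcal D$ is the set of these definitions. Let $\mathcal A$ be a set of formulas and $\alpha$ a formula, all of the form $\forall \bar x.\,\eta(\bar x)$ with $\bar x$ of foreground sort and $\eta$ quantifier-free. An *LFP model* is a model in which the recursively defined relations are the simultaneous least fixpoint of their definitions. $\Phi\cup\mathcal D\models_{\mathsf{LFP}}\varphi$ means that $\varphi$ holds in all LFP models of $\Phi$; $\Phi\cup\mathcal D\models_{\mathsf{FO}}\varphi$ means that $\varphi$ holds in all models of $\Phi$ that satisfy $\forall\bar x.\,R(\bar x)\leftrightarrow\rho_R(\bar x)$ for all recursively defined $R$. In the sets of formulas below, $\mathcal D$ stands for these first-order formulas. A *lemma* is a formula $L=\forall\bar x.\,R(\bar x)\to\psi(\bar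 x)$ with $R$ recursively defined and $\psi$ quantifier-free. $PFP(L)$ is $\forall\bar x.\ \rho_R(\bar x, R\leftarrow \psi\wedge R)\to\psi(\bar x)$, where each atom $R(\bar t)$ in $\rho_R$ is replaced by $\psi(\bar t)\wedge R(\bar t)$. For an element tuple or constant tuple $\bar u$, $L[\bar u]$ and $PFP(L[\bar u])$ denote the quantifier-free bodies at $\bar x=\bar u$. A set $\mathcal L$ of lemmas *proves* $\alpha$ if $\mathcal A\cup\mathcal D\cup\mathcal L\models_{\mathsf{FO}}\alpha$ and $\mathcal A\cup\mathcal D\models_{\mathsf{LFP}}L$ for all $L\in\mathcal L$. It is a set of *independent inductive lemmas* if $\mathcal A\cup\mathcal D\models_{\mathsf{FO}}PFP(L)$ for all $L\in\mathcal L$. For a set $\Phi$ of universal formulas, negated universal formulas being Skolemized by fresh constants of foreground sort, $T_k(\Phi)$ is the set of ground terms of foreground sort of depth at most $k$ over $\Sigma$ and the Skolem constants of $\Phi$, and $\Phi[T_k(\Phi)]$ is the set of all instances of the formulas of $\Phi$ by terms in $T_k(\Phi)$. $\mathrm{SAT}$ is satisfiability in a model (of $T$). **Algorithm** with input $\mathcal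 A,\mathcal D,\alpha$ and depth $k$, and with an arbitrary set $\mathcal G$ of LFP models of $\mathcal A\cup\mathcal D$. Fix, for each $R$, a tuple $\bar c_R$ of fresh constants. Start with $\mathcal L=\emptyset$ and $\mathcal M_R=\emptyset$ for all $R$. 1. Let $\Phi_\alpha=\mathcal A\cup\mathcal D\cup\mathcal L\cup\{\neg\alpha\}$. If $\Phi_\alpha[T_k(\Phi_\alpha)]$ is unsatisfiable, stop and output $\mathcal L$. Otherwise take any model $M$ of it, let $U_k$ be the set of values in $M$ of the terms in $T_k(\Phi_\alpha)$, and go to 2. 2. Select a *candidate*, that is, a lemma $L=\forall\bar x.\,R(\bar x)\to\psi(\bar x)$ such that (a) $M\not\models L[\bar u]$ for some tuple $\bar u$ from $U_k$; (b) $N\models PFP(L[\bar c_R])$ for all $N\in\mathcal M_R$; (c) $G\models L$ for all $G\in\mathcal G$. If there is no candidate, stop with "no proof found". 3. Let $\Phi_L=\mathcal A\cup\mathcal D\cup\mathcal L\cup\{\neg PFP(L[\bar c_R])\}$. If $\Phi_L[T_k(\Phi_L)]$ is satisfiable, add any model of it to $\mathcal M_R$ and go to 2 (with the same $M$). Otherwise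 add $L$ to $\mathcal L$, reset all $\mathcal M_R$ to $\emptyset$, and go to 1. The selection procedure in step 2 may be nondeterministic; it selects a candidate whenever there is one. It is *fair* if there is a finite set $B(L)$ of lemmas for each lemma $L$ (the lemmas that might be selected before $L$) such that, whenever $L$ is a candidate, the selected lemma is $L$ or belongs to $B(L)$. **Theorem.** Assume that there is a ground term of foreground sort over $\Sigma$, or else that $\alpha$ has at least one quantified variable and all recursively defined relations have positive arity. Suppose there is a finite set $\hat{\mathcal L}$ of independent inductive lemmas with $\mathcal A\cup\mathcal D\cup\hat{\mathcal L}\models_{\mathsf{FO}}\alpha$. Then there is a depth $k$ such that for every set $\mathcal G$ of LFP models of $\mathcal A\cup\mathcal D$, every fair selection procedure and all choices of models, the algorithm with depth $k$ terminates, and its output is a finite set $\mathcal L$ of lemmas that proves $\alpha$ (in particular it does not stop with "no proof found"). -/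

import Mathlib

universe u v

namespace LemmaSynthesis

/-! ### Many-sorted first-order logic with a foreground sort -/

/-- A many-sorted signature with a designated foreground sort `fg`; every other sort is a background
sort. Constants are function symbols of arity `0`. The relation symbols are split into the symbols
`Rel` without a recursive definition (of arbitrary type) and the symbols `RecRel` that have a
recursive definition (relations over the foreground sort). -/
structure Sig : Type (u + 1) where
  Srt : Type u
  fg : Srt
  Fn : Type u
  fnArity : Fn → ℕ
  dom : (f : Fn) → Fin (fnArity f) → Srt
  cod : Fn → Srt
  Rel : Type u
  relArity : Rel → ℕ
  relDom : (R : Rel) → Fin (relArity R) → Srt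
  RecRel : Type u
  recArity : RecRel → ℕ

/-- The context of `n` variables of foreground sort. -/
abbrev Sig.fgCtx (S : Sig.{u}) (n : ℕ) : Fin n → S.Srt := fun _ => S.fg

/-- Terms, indexed by their sort; the variable `x : V` has sort `Γ x`. -/
inductive Term (S : Sig.{u}) {V : Type v} (Γ : V → S.Srt) : S.Srt → Type (max u v)
  | var (x : V) : Term S Γ (Γ x)
  | app (f : S.Fn) (ts : (i : Fin (S.fnArity f)) → Term S Γ (S.dom f i)) : Term S Γ (S.cod f)

/-- Atomic formulas. -/
inductive Atom (S : Sig.{u}) {V : Type v} (Γ : V → S.Srt) : Type (max u v)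
  | eq {σ : S.Srt} (s t : Term S Γ σ) : Atom S Γ
  | rel (R : S.Rel) (ts : (i : Fin (S.relArity R)) → Term S Γ (S.relDom R i)) : Atom S Γ
  | recRel (R : S.RecRel) (ts : Fin (S.recArity R) → Term S Γ S.fg) : Atom S Γ

/-- Quantifier-free formulas with variables in the context `Γ`. -/
inductive QF (S : Sig.{u}) {V : Type v} (Γ : V → S.Srt) : Type (max u v)
  | atom (a : Atom S Γ) : QF S Γ
  | fls : QF S Γ
  | neg (φ : QF S Γ) : QF S Γ
  | and (φ ψ : QF S Γ) : QF S Γ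
  | or (φ ψ : QF S Γ) : QF S Γ
  | imp (φ ψ : QF S Γ) : QF S Γ

/-- Arbitrary first-order formulas. The variables are the pairs `(σ, n)`, the `n`-th variable of
sort `σ`. They are used for the background theory only. -/
inductive FO (S : Sig.{u}) : Type u
  | atom (a : Atom S (Prod.fst : S.Srt × ℕ → S.Srt)) : FO S
  | fls : FO S
  | neg (φ : FO S) : FO S
  | and (φ ψ : FO S) : FO S
  | or (φ ψ : FO S) : FO S
  | imp (φ ψ : FO S) : FO S
  | all (σ : S.Srt) (n : ℕ) (φ : FO S) : FO S
  | ex (σ : S.Srt) (n : ℕ) (φ : FO S) : FO S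

/-- `∀ x₁ … xₙ, body` with all variables of foreground sort and `body` quantifier-free. -/
structure Univ (S : Sig.{u}) : Type u where
  n : ℕ
  body : QF S (S.fgCtx n)

section Formulas

variable {S : Sig.{u}} {V : Type v} {Γ : V → S.Srt}

/-- Constants and variables have depth `0`. -/
def Term.depth : {σ : S.Srt} → Term S Γ σ → ℕ
  | _, .var _ => 0
  | _, .app _ ts => Finset.univ.sup fun i => (ts i).depth + 1

def Term.subst {W : Type*} {Δ : W → S.Srt} (s : (x : V) → Term S Δ (Γ x)) :
    {σ : S.Srt} → Term S Γ σ → Term S Δ σ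
  | _, .var x => s x
  | _, .app f ts => .app f fun i => (ts i).subst s

def Atom.subst {W : Type*} {Δ : W → S.Srt} (s : (x : V) → Term S Δ (Γ x)) :
    Atom S Γ → Atom S Δ
  | .eq t t' => .eq (t.subst s) (t'.subst s)
  | .rel R ts => .rel R fun i => (ts i).subst s
  | .recRel R ts => .recRel R fun i => (ts i).subst s

def QF.subst {W : Type*} {Δ : W → S.Srt} (s : (x : V) → Term S Δ (Γ x)) : QF S Γ → QF S Δ
  | .atom a => .atom (a.subst s)
  | .fls => .fls
  | .neg φ => .neg (φ.subst s)
  | .and φ ψ => .and (φ.subst s) (ψ.subst s)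
  | .or φ ψ => .or (φ.subst s) (ψ.subst s)
  | .imp φ ψ => .imp (φ.subst s) (ψ.subst s)

/-- `φ.RecPolarity true`: recursively defined relations occur only positively in `φ`;
`φ.RecPolarity false`: they occur only negatively. -/
def QF.RecPolarity : Bool → QF S Γ → Prop
  | b, .atom (.recRel _ _) => b = true
  | _, .atom (.eq _ _) => True
  | _, .atom (.rel _ _) => True
  | _, .fls => True
  | b, .neg φ => φ.RecPolarity (!b)
  | b, .and φ ψ => φ.RecPolarity b ∧ ψ.RecPolarity b
  | b, .or φ ψ => φ.RecPolarity b ∧ ψ.RecPolarity b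
  | b, .imp φ ψ => φ.RecPolarity (!b) ∧ ψ.RecPolarity b

open Classical in
/-- `φ(R ← ψ ∧ R)`: every atom `R(t₁, …, tₘ)` in `φ` is replaced by
`ψ(t₁, …, tₘ) ∧ R(t₁, …, tₘ)`. -/
noncomputable def QF.strengthen (R : S.RecRel) (ψ : QF S (S.fgCtx (S.recArity R))) :
    QF S Γ → QF S Γ
  | .atom (.recRel Q ts) =>
      if h : Q = R then
        .and (ψ.subst fun i => ts (Fin.cast (congrArg S.recArity h.symm) i)) (.atom (.recRel Q ts))
      else .atom (.recRel Q ts)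
  | .atom (.eq s t) => .atom (.eq s t)
  | .atom (.rel Q ts) => .atom (.rel Q ts)
  | .fls => .fls
  | .neg φ => .neg (strengthen R ψ φ)
  | .and φ χ => .and (strengthen R ψ φ) (strengthen R ψ χ)
  | .or φ χ => .or (strengthen R ψ φ) (strengthen R ψ χ)
  | .imp φ χ => .imp (strengthen R ψ φ) (strengthen R ψ χ)

/-- All subterms are of background sort. -/
def Term.IsBackground : {σ : S.Srt} → Term S Γ σ → Prop
  | _, .var x => Γ x ≠ S.fg
  | _, .app f ts => S.cod f ≠ S.fg ∧ ∀ i, (ts i).IsBackground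

def Atom.IsBackground : Atom S Γ → Prop
  | .eq s t => s.IsBackground ∧ t.IsBackground
  | .rel _ ts => ∀ i, (ts i).IsBackground
  | .recRel _ _ => False

/-- The formula does not involve the foreground sort. -/
def FO.IsBackground : FO S → Prop
  | .atom a => a.IsBackground
  | .fls => True
  | .neg φ => φ.IsBackground
  | .and φ ψ => φ.IsBackground ∧ ψ.IsBackground
  | .or φ ψ => φ.IsBackground ∧ ψ.IsBackground
  | .imp φ ψ => φ.IsBackground ∧ ψ.IsBackground
  | .all σ _ φ => σ ≠ S.fg ∧ φ.IsBackground
  | .ex σ _ φ => σ ≠ S.fg ∧ φ.IsBackground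

end Formulas

/-! ### Semantics -/

/-- Structures, with non-empty sorts. -/
structure Str (S : Sig.{u}) : Type (u + 1) where
  carrier : S.Srt → Type u
  nonempty : ∀ σ, Nonempty (carrier σ)
  fn : (f : S.Fn) → ((i : Fin (S.fnArity f)) → carrier (S.dom f i)) → carrier (S.cod f)
  rel : (R : S.Rel) → ((i : Fin (S.relArity R)) → carrier (S.relDom R i)) → Prop
  recRel : (R : S.RecRel) → (Fin (S.recArity R) → carrier S.fg) → Prop

section Semantics

variable {S : Sig.{u}} {V : Type v} {Γ : V → S.Srt}

def Term.eval (M : Str S) (w : (x : V) → M.carrier (Γ x)) :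
    {σ : S.Srt} → Term S Γ σ → M.carrier σ
  | _, .var x => w x
  | _, .app f ts => M.fn f fun i => (ts i).eval M w

def Atom.Eval (M : Str S) (w : (x : V) → M.carrier (Γ x)) : Atom S Γ → Prop
  | .eq s t => s.eval M w = t.eval M w
  | .rel R ts => M.rel R fun i => (ts i).eval M w
  | .recRel R ts => M.recRel R fun i => (ts i).eval M w

def QF.Eval (M : Str S) (w : (x : V) → M.carrier (Γ x)) : QF S Γ → Prop
  | .atom a => a.Eval M w
  | .fls => False
  | .neg φ => ¬ φ.Eval M w
  | .and φ ψ => φ.Eval M w ∧ ψ.Eval M w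
  | .or φ ψ => φ.Eval M w ∨ ψ.Eval M w
  | .imp φ ψ => φ.Eval M w → ψ.Eval M w

open Classical in
def FO.Eval (M : Str S) : ((x : S.Srt × ℕ) → M.carrier x.1) → FO S → Prop
  | w, .atom a => a.Eval M w
  | _, .fls => False
  | w, .neg φ => ¬ φ.Eval M w
  | w, .and φ ψ => φ.Eval M w ∧ ψ.Eval M w
  | w, .or φ ψ => φ.Eval M w ∨ ψ.Eval M w
  | w, .imp φ ψ => φ.Eval M w → ψ.Eval M w
  | w, .all σ n φ => ∀ a : M.carrier σ, φ.Eval M (Function.update w (σ, n) a)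
  | w, .ex σ n φ => ∃ a : M.carrier σ, φ.Eval M (Function.update w (σ, n) a)

/-- Truth of the universal closure. -/
def FO.Holds (M : Str S) (φ : FO S) : Prop := ∀ w, φ.Eval M w

def Univ.Holds (M : Str S) (φ : Univ S) : Prop :=
  ∀ w : Fin φ.n → M.carrier S.fg, φ.body.Eval M w

end Semantics

/-! ### Recursive definitions and lemmas -/

/-- A definition `R(x₁, …, xₘ) :=_lfp body R` for every `R : S.RecRel`, where the recursively defined
relations occur only positively in `body R`. -/
structure RecDefs (S : Sig.{u}) : Type u where
  body : (R : S.RecRel) → QF S (S.fgCtx (S.recArity R))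
  pos : ∀ R, (body R).RecPolarity true

/-- The lemma `∀ x₁ … xₘ, R(x₁, …, xₘ) → ψ(x₁, …, xₘ)`, with `ψ` quantifier-free. -/
structure IndLemma (S : Sig.{u}) : Type u where
  R : S.RecRel
  ψ : QF S (S.fgCtx (S.recArity R))

section Recursion

variable {S : Sig.{u}}

/-- The atom `R(x₁, …, xₘ)`. -/
def recAtom (R : S.RecRel) : QF S (S.fgCtx (S.recArity R)) :=
  .atom (.recRel R fun i => Term.var (Γ := S.fgCtx (S.recArity R)) i)

/-- The recursive definitions read as formulas `∀ x₁ … xₘ, R(x₁, …, xₘ) ↔ body R`. -/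
def RecDefs.toUniv (D : RecDefs S) : Set (Univ S) :=
  Set.range fun R =>
    ⟨S.recArity R, .and (.imp (recAtom R) (D.body R)) (.imp (D.body R) (recAtom R))⟩

/-- `M` with the recursively defined relations reinterpreted by `I`. -/
def Str.withRec (M : Str S) (I : (R : S.RecRel) → (Fin (S.recArity R) → M.carrier S.fg) → Prop) :
    Str S :=
  { M with recRel := I }

/-- The operator on interpretations of the recursively defined relations given by the definitions. -/
def RecDefs.op (D : RecDefs S) (M : Str S)
    (I : (R : S.RecRel) → (Fin (S.recArity R) → M.carrier S.fg) → Prop) :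
    (R : S.RecRel) → (Fin (S.recArity R) → M.carrier S.fg) → Prop :=
  fun R w => (D.body R).Eval (M.withRec I) w

/-- The recursively defined relations are interpreted in `M` by the (simultaneous) least fixpoint of
their definitions. -/
def RecDefs.IsLFP (D : RecDefs S) (M : Str S) : Prop :=
  IsLeast (Function.fixedPoints (D.op M)) M.recRel

def IndLemma.toUniv (L : IndLemma S) : Univ S :=
  ⟨S.recArity L.R, .imp (recAtom L.R) L.ψ⟩

/-- `PFP(L) = ∀ x₁ … xₘ, (body R)(R ← ψ ∧ R) → ψ`. -/
noncomputable def IndLemma.pfp (D : RecDefs S) (L : IndLemma S) : Univ S :=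
  ⟨S.recArity L.R, .imp (QF.strengthen L.R L.ψ (D.body L.R)) L.ψ⟩

end Recursion

/-- The data of a proof problem: a first-order theory constraining the background sorts, recursive
definitions `D`, universally quantified assumptions `A` and a universally quantified goal `α`. -/
structure Problem (S : Sig.{u}) : Type u where
  theory : Set (FO S)
  theory_background : ∀ φ ∈ theory, φ.IsBackground
  D : RecDefs S
  A : Set (Univ S)
  α : Univ S

namespace Problem

variable {S : Sig.{u}} (P : Problem S)

/-- `Φ ⊨_FO φ`, modulo the background theory. -/
def FOEntails (Φ : Set (Univ S)) (φ : Univ S) : Prop :=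
  ∀ M : Str S, (∀ τ ∈ P.theory, τ.Holds M) → (∀ χ ∈ Φ, χ.Holds M) → φ.Holds M

/-- `M` is an LFP model of `A ∪ D` (and of the background theory). -/
def IsLFPModel (M : Str S) : Prop :=
  (∀ τ ∈ P.theory, τ.Holds M) ∧ (∀ χ ∈ P.A, χ.Holds M) ∧ P.D.IsLFP M

/-- `A ∪ D ⊨_LFP φ`. -/
def LFPEntails (φ : Univ S) : Prop := ∀ M : Str S, P.IsLFPModel M → φ.Holds M

/-- The formulas `A ∪ D ∪ 𝓛`, with the recursive definitions in their first-order reading. -/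
def withLemmas (𝓛 : Set (IndLemma S)) : Set (Univ S) :=
  P.A ∪ P.D.toUniv ∪ IndLemma.toUniv '' 𝓛

/-- `L` is inductive for `A ∪ D`: `A ∪ D ⊨_FO PFP(L)`. -/
def Inductive (L : IndLemma S) : Prop := P.FOEntails (P.A ∪ P.D.toUniv) (L.pfp P.D)

/-- `𝓛` proves `α`: `A ∪ D ∪ 𝓛 ⊨_FO α` and all lemmas in `𝓛` are LFP-valid. -/
def Proves (𝓛 : Set (IndLemma S)) : Prop :=
  P.FOEntails (P.withLemmas 𝓛) P.α ∧ ∀ L ∈ 𝓛, P.LFPEntails L.toUniv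

/-! ### Instantiation

The signature extended by `n` fresh Skolem constants `c₁, …, cₙ` of foreground sort is represented
by the context `S.fgCtx n`: its ground terms are the terms in that context, its ground formulas
are the quantifier-free formulas in that context, and its models are the models of `S` together
with the values of `c₁, …, cₙ`. -/

/-- A model (of the background theory) over the signature extended by `n` Skolem constants. -/
structure CModel (n : ℕ) : Type (u + 1) where
  M : Str S
  theory_holds : ∀ τ ∈ P.theory, τ.Holds M
  c : Fin n → M.carrier S.fg

/-- `T_k`: the ground terms of foreground sort of depth at most `k` over the signature extended by `n`
Skolem constants. -/
def groundTerms (S : Sig.{u}) (n k : ℕ) : Set (Term S (S.fgCtx n) S.fg) := {t | t.depth ≤ k}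

/-- `Φ[T_k]`. -/
def instances (Φ : Set (Univ S)) (n k : ℕ) : Set (QF S (S.fgCtx n)) :=
  {χ | ∃ φ ∈ Φ, ∃ t : Fin φ.n → Term S (S.fgCtx n) S.fg,
    (∀ i, t i ∈ groundTerms S n k) ∧ χ = φ.body.subst t}

variable {P} in
def CModel.Models {n : ℕ} (N : P.CModel n) (Ψ : Set (QF S (S.fgCtx n))) : Prop :=
  ∀ χ ∈ Ψ, χ.Eval N.M N.c

/-- `SAT(Ψ)`, modulo the background theory. -/
def Sat {n : ℕ} (Ψ : Set (QF S (S.fgCtx n))) : Prop := ∃ N : P.CModel n, N.Models Ψ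

/-- `Φ_α[T_k]` for `Φ_α = A ∪ D ∪ 𝓛 ∪ {¬ α}`; the variables of `α` become the Skolem constants. -/
def goalInstances (k : ℕ) (𝓛 : Set (IndLemma S)) : Set (QF S (S.fgCtx P.α.n)) :=
  instances (P.withLemmas 𝓛) P.α.n k ∪ {.neg P.α.body}

/-- `Φ_L[T_k]` for `Φ_L = A ∪ D ∪ 𝓛 ∪ {¬ PFP(L[c_R])}`. -/
noncomputable def pfpInstances (k : ℕ) (𝓛 : Set (IndLemma S)) (L : IndLemma S) :
    Set (QF S (S.fgCtx (S.recArity L.R))) :=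
  instances (P.withLemmas 𝓛) (S.recArity L.R) k ∪ {.neg (L.pfp P.D).body}

/-! ### The algorithm -/

/-- The constraints on the lemma `L` that is to be selected, given the current model `M` and the
current sets `𝓜 R` of models. -/
structure Candidate (𝒢 : Set (Str S)) (k : ℕ) (M : P.CModel P.α.n)
    (𝓜 : (R : S.RecRel) → Set (P.CModel (S.recArity R))) (L : IndLemma S) : Prop where
  /-- `L` is false in `M` on some tuple of values of terms from `T_k`. -/
  false_on_terms : ∃ w : Fin (S.recArity L.R) → M.M.carrier S.fg,
    (∀ i, ∃ t ∈ groundTerms S P.α.n k, t.eval M.M M.c = w i) ∧ ¬ L.toUniv.body.Eval M.M w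
  /-- `PFP(L[c_R])` is true in all models in `𝓜 R`. -/
  pfp_true : ∀ N ∈ 𝓜 L.R, (L.pfp P.D).body.Eval N.M N.c
  /-- `L` is true in all good models. -/
  good : ∀ G ∈ 𝒢, L.toUniv.Holds G

/-- Control states of the algorithm: before the test of the outer loop, at the start of the body of
the inner loop, and the two ways of stopping. -/
inductive State : Type (u + 1)
  | outer (𝓛 : Set (IndLemma S)) (𝓜 : (R : S.RecRel) → Set (P.CModel (S.recArity R))) : State
  | inner (𝓛 : Set (IndLemma S)) (M : P.CModel P.α.n)
      (𝓜 : (R : S.RecRel) → Set (P.CModel (S.recArity R))) : State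
  | output (𝓛 : Set (IndLemma S)) : State
  | noProofFound : State

/-- A (possibly nondeterministic) lemma selection procedure: `picks 𝓛 M 𝓜 L` says that `L` may be
selected. It selects candidates only, and it selects one whenever there is one. -/
structure Selector (𝒢 : Set (Str S)) (k : ℕ) : Type (u + 1) where
  picks : Set (IndLemma S) → P.CModel P.α.n →
    ((R : S.RecRel) → Set (P.CModel (S.recArity R))) → IndLemma S → Prop
  sound : ∀ 𝓛 M 𝓜 L, picks 𝓛 M 𝓜 L → P.Candidate 𝒢 k M 𝓜 L
  total : ∀ 𝓛 M 𝓜, (∃ L, P.Candidate 𝒢 k M 𝓜 L) → ∃ L, picks 𝓛 M 𝓜 L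

variable {P} in
/-- For every lemma `L` there is a finite set `before L` such that, whenever `L` is a candidate, the
selected lemma is `L` or belongs to `before L`. -/
def Selector.Fair {𝒢 : Set (Str S)} {k : ℕ} (sel : P.Selector 𝒢 k) : Prop :=
  ∃ before : IndLemma S → Set (IndLemma S), (∀ L, (before L).Finite) ∧
    ∀ 𝓛 M 𝓜 L L', P.Candidate 𝒢 k M 𝓜 L → sel.picks 𝓛 M 𝓜 L' → L' = L ∨ L' ∈ before L

open Classical in
/-- One step of the algorithm. The models `M` and `N` are arbitrary. -/
inductive Step {𝒢 : Set (Str S)} {k : ℕ} (sel : P.Selector 𝒢 k) : P.State → P.State → Prop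
  | enter {𝓛 𝓜} (M : P.CModel P.α.n) (hM : M.Models (P.goalInstances k 𝓛)) :
      Step sel (.outer 𝓛 𝓜) (.inner 𝓛 M 𝓜)
  | exit {𝓛 𝓜} (h : ¬ P.Sat (P.goalInstances k 𝓛)) :
      Step sel (.outer 𝓛 𝓜) (.output 𝓛)
  | stuck {𝓛 M 𝓜} (h : ¬ ∃ L, P.Candidate 𝒢 k M 𝓜 L) :
      Step sel (.inner 𝓛 M 𝓜) .noProofFound
  | refute {𝓛 M 𝓜} (L : IndLemma S) (hL : sel.picks 𝓛 M 𝓜 L)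
      (N : P.CModel (S.recArity L.R)) (hN : N.Models (P.pfpInstances k 𝓛 L)) :
      Step sel (.inner 𝓛 M 𝓜)
        (.inner 𝓛 M (Function.update 𝓜 L.R (insert N (𝓜 L.R))))
  | learn {𝓛 M 𝓜} (L : IndLemma S) (hL : sel.picks 𝓛 M 𝓜 L)
      (h : ¬ P.Sat (P.pfpInstances k 𝓛 L)) :
      Step sel (.inner 𝓛 M 𝓜) (.outer (insert L 𝓛) fun _ => ∅)

/-- The initial state. -/
def init : P.State := .outer ∅ fun _ => ∅

end Problem

end LemmaSynthesis

open LemmaSynthesis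

/-! The depth `k` comes from a Herbrand theorem modulo the background theory. Suppose a universal
theory and a ground formula have models of their instances at every depth. An ultraproduct of these
models satisfies the instances of all depths at once. Shrinking its foreground sort to the values of
terms turns instances into universal truth. The background theory survives because it speaks only of
the untouched background sorts (`exists_model_of_forall_sat`). As the given lemma set is finite, one
depth refutes both the negated goal and all negated induction steps (`SufficientDepth`).

At this depth some given lemma is always a candidate (`exists_candidate`). If none were false on the
terms, the current model would satisfy all instances of the given lemmas and of the negated goal. A
given lemma that is false there passes the other two tests, being inductive at depth `k` and hence
valid in LFP models. So the algorithm cannot get stuck.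

Learned lemmas are sound: each is inductive relative to earlier valid ones, and its strengthened
interpretation is a prefixed point, hence above the least fixpoint (`holds_of_pfp`).

Since a given lemma is always a candidate, fairness confines all selections to one finite set. There
every refutation kills a live lemma and every success learns a new one, so a lexicographic measure
decreases (`measure_lt`). -/

namespace LemmaSynthesis

variable {S : Sig.{u}} {V : Type v} {Γ : V → S.Srt}

/-! ### Evaluation and substitution -/

theorem Term.eval_subst (M : Str S) {W : Type*} {Δ : W → S.Srt} (w : (x : W) → M.carrier (Δ x))
    (s : (x : V) → Term S Δ (Γ x)) {σ : S.Srt} (t : Term S Γ σ) :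
    (t.subst s).eval M w = t.eval M fun x => (s x).eval M w := by
  induction t with
  | var x => rfl
  | app f ts ih => simp only [Term.subst, Term.eval, ih]

theorem Atom.eval_subst (M : Str S) {W : Type*} {Δ : W → S.Srt} (w : (x : W) → M.carrier (Δ x))
    (s : (x : V) → Term S Δ (Γ x)) (a : Atom S Γ) :
    (a.subst s).Eval M w ↔ a.Eval M fun x => (s x).eval M w := by
  cases a <;> simp only [Atom.subst, Atom.Eval, Term.eval_subst]

theorem QF.eval_subst (M : Str S) {W : Type*} {Δ : W → S.Srt} (w : (x : W) → M.carrier (Δ x))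
    (s : (x : V) → Term S Δ (Γ x)) (φ : QF S Γ) :
    (φ.subst s).Eval M w ↔ φ.Eval M fun x => (s x).eval M w := by
  induction φ with
  | atom a => exact Atom.eval_subst M w s a
  | fls => rfl
  | neg φ ih => simp only [QF.subst, QF.Eval, ih]
  | and φ ψ ih₁ ih₂ => simp only [QF.subst, QF.Eval, ih₁, ih₂]
  | or φ ψ ih₁ ih₂ => simp only [QF.subst, QF.Eval, ih₁, ih₂]
  | imp φ ψ ih₁ ih₂ => simp only [QF.subst, QF.Eval, ih₁, ih₂]

/-! ### Ultraproducts -/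

section Ultraproduct

variable {ι : Type} (U : Ultrafilter ι) (N : ι → Str S)

/-- The ultraproduct of a family of structures. -/
noncomputable def ultraproduct : Str S where
  carrier σ := (U : Filter ι).Product fun i => (N i).carrier σ
  nonempty σ := ⟨Quotient.mk _ fun i => ((N i).nonempty σ).some⟩
  fn f x := Quotient.mk _ fun i => (N i).fn f fun j => (x j).out i
  rel R x := ∀ᶠ i in (U : Filter ι), (N i).rel R fun j => (x j).out i
  recRel R x := ∀ᶠ i in (U : Filter ι), (N i).recRel R fun j => (x j).out i

variable {N}

/-- The element of the ultraproduct given by a family of elements. -/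
def ultraproduct.mk {σ : S.Srt} (x : (i : ι) → (N i).carrier σ) : (ultraproduct U N).carrier σ :=
  Quotient.mk (Filter.productSetoid (U : Filter ι) fun i => (N i).carrier σ) x

namespace ultraproduct

theorem mk_eq {σ : S.Srt} {x y : (i : ι) → (N i).carrier σ} :
    mk U x = mk U y ↔ ∀ᶠ i in (U : Filter ι), x i = y i := by
  unfold mk
  exact Quotient.eq

theorem exists_mk {σ : S.Srt} (x : (ultraproduct U N).carrier σ) : ∃ y, mk U y = x :=
  Quotient.exists_rep x

/-- Arities are finite, so the chosen representatives of all arguments agree with the given families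
simultaneously on a set of the ultrafilter. Hence the choice made in `ultraproduct` is immaterial.
-/
theorem out_mk {n : ℕ} {d : Fin n → S.Srt} (x : (j : Fin n) → (i : ι) → (N i).carrier (d j)) :
    ∀ᶠ i in (U : Filter ι), (fun j => (mk U (x j)).out i) = fun j => x j i := by
  have h : ∀ j, ∀ᶠ i in (U : Filter ι), (mk U (x j)).out i = x j i := fun j =>
    (mk_eq U).1 (Quotient.out_eq _)
  filter_upwards [Filter.eventually_all.2 h] with i hi
  exact funext hi

theorem fn_mk (f : S.Fn) (x : (j : Fin (S.fnArity f)) → (i : ι) → (N i).carrier (S.dom f j)) :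
    (ultraproduct U N).fn f (fun j => mk U (x j)) = mk U fun i => (N i).fn f fun j => x j i := by
  refine (mk_eq U).2 ?_
  filter_upwards [out_mk U x] with i hi
  rw [hi]

theorem rel_mk (R : S.Rel) (x : (j : Fin (S.relArity R)) → (i : ι) → (N i).carrier (S.relDom R j)) :
    (ultraproduct U N).rel R (fun j => mk U (x j)) ↔
      ∀ᶠ i in (U : Filter ι), (N i).rel R fun j => x j i := by
  refine Filter.eventually_congr ?_
  filter_upwards [out_mk U x] with i hi
  rw [hi]

theorem recRel_mk (R : S.RecRel) (x : Fin (S.recArity R) → (i : ι) → (N i).carrier S.fg) :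
    (ultraproduct U N).recRel R (fun j => mk U (x j)) ↔
      ∀ᶠ i in (U : Filter ι), (N i).recRel R fun j => x j i := by
  refine Filter.eventually_congr ?_
  filter_upwards [out_mk U x] with i hi
  rw [hi]

variable (w : (x : V) → (i : ι) → (N i).carrier (Γ x))

theorem term_eval {σ : S.Srt} (t : Term S Γ σ) :
    t.eval (ultraproduct U N) (fun x => mk U (w x)) =
      mk U fun i => t.eval (N i) fun x => w x i := by
  induction t with
  | var x => rfl
  | app f ts ih => simp only [Term.eval, ih, fn_mk]

theorem atom_eval (a : Atom S Γ) :
    a.Eval (ultraproduct U N) (fun x => mk U (w x)) ↔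
      ∀ᶠ i in (U : Filter ι), a.Eval (N i) fun x => w x i := by
  cases a with
  | eq s t => simp only [Atom.Eval, term_eval, mk_eq]
  | rel R ts => simp only [Atom.Eval, term_eval, rel_mk]
  | recRel R ts => simp only [Atom.Eval, term_eval, recRel_mk]

theorem qf_eval (φ : QF S Γ) :
    φ.Eval (ultraproduct U N) (fun x => mk U (w x)) ↔
      ∀ᶠ i in (U : Filter ι), φ.Eval (N i) fun x => w x i := by
  induction φ with
  | atom a => exact atom_eval U w a
  | fls => simp [QF.Eval, U.neBot.ne]
  | neg φ ih => simp only [QF.Eval, ih, Ultrafilter.eventually_not]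
  | and φ ψ ih₁ ih₂ => simp only [QF.Eval, ih₁, ih₂, Filter.eventually_and]
  | or φ ψ ih₁ ih₂ => simp only [QF.Eval, ih₁, ih₂, Ultrafilter.eventually_or]
  | imp φ ψ ih₁ ih₂ => simp only [QF.Eval, ih₁, ih₂, Ultrafilter.eventually_imp]

open Classical in
theorem update_mk (w : (x : S.Srt × ℕ) → (i : ι) → (N i).carrier x.1) (p : S.Srt × ℕ)
    (a : (i : ι) → (N i).carrier p.1) :
    Function.update (β := fun x : S.Srt × ℕ => (ultraproduct U N).carrier x.1)
        (fun x => mk U (w x)) p (mk U a) =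
      fun x => mk U (Function.update w p a x) := by
  funext x
  by_cases h : x = p
  · subst h; simp
  · simp [h]

open Classical in
theorem update_apply (w : (x : S.Srt × ℕ) → (i : ι) → (N i).carrier x.1) (p : S.Srt × ℕ)
    (a : (i : ι) → (N i).carrier p.1) (i : ι) :
    (fun x => Function.update w p a x i) = Function.update (fun x => w x i) p (a i) := by
  funext x
  by_cases h : x = p
  · subst h; simp
  · simp [h]

open Classical in
/-- Łoś's theorem. -/
theorem fo_eval (φ : FO S) (w : (x : S.Srt × ℕ) → (i : ι) → (N i).carrier x.1) :
    φ.Eval (ultraproduct U N) (fun x => mk U (w x)) ↔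
      ∀ᶠ i in (U : Filter ι), φ.Eval (N i) fun x => w x i := by
  induction φ generalizing w with
  | atom a => exact atom_eval U w a
  | fls => simp [FO.Eval, U.neBot.ne]
  | neg φ ih => simp only [FO.Eval, ih, Ultrafilter.eventually_not]
  | and φ ψ ih₁ ih₂ => simp only [FO.Eval, ih₁, ih₂, Filter.eventually_and]
  | or φ ψ ih₁ ih₂ => simp only [FO.Eval, ih₁, ih₂, Ultrafilter.eventually_or]
  | imp φ ψ ih₁ ih₂ => simp only [FO.Eval, ih₁, ih₂, Ultrafilter.eventually_imp]
  | all σ n φ ih =>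
    have key : ∀ a : (i : ι) → (N i).carrier σ, _ := fun a => by
      have := ih (Function.update w (σ, n) a)
      rw [← update_mk U w (σ, n) a] at this
      simpa only [update_apply w (σ, n) a] using this
    simp only [FO.Eval]
    constructor
    · intro h
      by_contra hc
      rw [← Ultrafilter.eventually_not] at hc
      -- A counterexample in each coordinate that has one, and an arbitrary element elsewhere; sorts
      -- are non-empty.
      have : ∀ i, ∃ a : (N i).carrier σ,
          ¬ (∀ a, φ.Eval (N i) (Function.update (fun x => w x i) (σ, n) a)) →
            ¬ φ.Eval (N i) (Function.update (fun x => w x i) (σ, n) a) := fun i => by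
        by_cases h' : ∀ a, φ.Eval (N i) (Function.update (fun x => w x i) (σ, n) a)
        · exact ⟨((N i).nonempty σ).some, fun h'' => absurd h' h''⟩
        · obtain ⟨a, ha⟩ := not_forall.1 h'
          exact ⟨a, fun _ => ha⟩
      choose a ha using this
      obtain ⟨i, h₁, h₂⟩ := (((key a).1 (h _)).and hc).exists
      exact ha i h₂ h₁
    · intro h a
      obtain ⟨a, rfl⟩ := exists_mk U a
      exact (key a).2 (h.mono fun i hi => hi _)
  | ex σ n φ ih =>
    have key : ∀ a : (i : ι) → (N i).carrier σ, _ := fun a => by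
      have := ih (Function.update w (σ, n) a)
      rw [← update_mk U w (σ, n) a] at this
      simpa only [update_apply w (σ, n) a] using this
    simp only [FO.Eval]
    constructor
    · rintro ⟨a, h⟩
      obtain ⟨a, rfl⟩ := exists_mk U a
      exact ((key a).1 h).mono fun i hi => ⟨_, hi⟩
    · intro h
      have : ∀ i, ∃ a : (N i).carrier σ,
          (∃ a, φ.Eval (N i) (Function.update (fun x => w x i) (σ, n) a)) →
            φ.Eval (N i) (Function.update (fun x => w x i) (σ, n) a) := fun i => by
        by_cases h' : ∃ a, φ.Eval (N i) (Function.update (fun x => w x i) (σ, n) a)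
        · exact ⟨h'.choose, fun _ => h'.choose_spec⟩
        · exact ⟨((N i).nonempty σ).some, fun h'' => absurd h'' h'⟩
      choose a ha using this
      exact ⟨mk U a, (key a).2 (h.mono fun i hi => ha i hi)⟩

theorem fo_holds {φ : FO S} (h : ∀ i, φ.Holds (N i)) : φ.Holds (ultraproduct U N) := by
  intro w
  choose w' hw' using fun x => exists_mk U (w x)
  obtain rfl : (fun x => mk U (w' x)) = w := funext hw'
  exact (fo_eval U φ w').2 (.of_forall fun i => h i _)

end ultraproduct

end Ultraproduct

/-! ### The substructure of the values of ground terms -/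

section Generated

variable (M : Str S) (c : (x : V) → M.carrier (Γ x))

/-- The values of terms, for the foreground sort; all elements, for a background sort. -/
def termValues (σ : S.Srt) : Set (M.carrier σ) :=
  {a | σ = S.fg → ∃ t : Term S Γ σ, t.eval M c = a}

theorem eval_mem_termValues {σ : S.Srt} (t : Term S Γ σ) : t.eval M c ∈ termValues M c σ :=
  fun _ => ⟨t, rfl⟩

/-- The only use of the term `t₀`: it keeps the restricted foreground sort non-empty. -/
theorem termValues_nonempty (t₀ : Term S Γ S.fg) (σ : S.Srt) : (termValues M c σ).Nonempty := by
  by_cases h : σ = S.fg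
  · subst h
    exact ⟨_, eval_mem_termValues M c t₀⟩
  · exact ⟨(M.nonempty σ).some, fun h' => absurd h' h⟩

variable (t₀ : Term S Γ S.fg)

open Classical in
/-- The structure in which the foreground sort is restricted to the values of terms. Values of
functions outside of this set are replaced by an arbitrary element of it. -/
noncomputable def restrictFg : Str S where
  carrier σ := termValues M c σ
  nonempty σ := (termValues_nonempty M c t₀ σ).to_subtype
  fn f x := if h : M.fn f (fun i => (x i).1) ∈ termValues M c (S.cod f) then ⟨_, h⟩
    else ⟨_, (termValues_nonempty M c t₀ (S.cod f)).some_mem⟩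
  rel R x := M.rel R fun i => (x i).1
  recRel R x := M.recRel R fun i => (x i).1

namespace restrictFg

theorem fn_val (f : S.Fn) (x : (i : Fin (S.fnArity f)) → (restrictFg M c t₀).carrier (S.dom f i))
    (h : M.fn f (fun i => (x i).1) ∈ termValues M c (S.cod f)) :
    ((restrictFg M c t₀).fn f x).1 = M.fn f fun i => (x i).1 := by
  simp only [restrictFg]
  rw [dif_pos h]

/-- The assignment `c`, in the restricted structure. -/
def assign (x : V) : (restrictFg M c t₀).carrier (Γ x) :=
  ⟨c x, eval_mem_termValues M c (.var x)⟩

/-- A function applied to background elements that are not values of terms may leave the restricted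
sort, but under the assignment `c` every subterm is itself a term value, so the replacement values
are never met. -/
theorem term_eval {σ : S.Srt} (t : Term S Γ σ) :
    (t.eval (restrictFg M c t₀) (assign M c t₀)).1 = t.eval M c := by
  induction t with
  | var x => rfl
  | app f ts ih =>
    simp only [Term.eval]
    have h := eval_mem_termValues M c (.app f ts)
    simp only [Term.eval, ← ih] at h
    rw [fn_val _ _ _ _ _ h]
    simp only [ih]

theorem atom_eval (a : Atom S Γ) :
    a.Eval (restrictFg M c t₀) (assign M c t₀) ↔ a.Eval M c := by
  cases a with
  | eq s t => simp only [Atom.Eval, ← term_eval M c t₀]; exact Subtype.ext_iff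
  | rel R ts => simp only [Atom.Eval, ← term_eval M c t₀]; rfl
  | recRel R ts => simp only [Atom.Eval, ← term_eval M c t₀]; rfl

theorem qf_eval (φ : QF S Γ) :
    φ.Eval (restrictFg M c t₀) (assign M c t₀) ↔ φ.Eval M c := by
  induction φ with
  | atom a => exact atom_eval M c t₀ a
  | fls => rfl
  | neg φ ih => simp only [QF.Eval, ih]
  | and φ ψ ih₁ ih₂ => simp only [QF.Eval, ih₁, ih₂]
  | or φ ψ ih₁ ih₂ => simp only [QF.Eval, ih₁, ih₂]
  | imp φ ψ ih₁ ih₂ => simp only [QF.Eval, ih₁, ih₂]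

/-- Membership in `termValues` is vacuous for background sorts, so functions into them are
unchanged. -/
theorem background_term_eval {W : Type*} {Δ : W → S.Srt} {σ : S.Srt} (t : Term S Δ σ)
    (ht : t.IsBackground) (w : (x : W) → (restrictFg M c t₀).carrier (Δ x)) :
    (t.eval (restrictFg M c t₀) w).1 = t.eval M fun x => (w x).1 := by
  induction t with
  | var x => rfl
  | app f ts ih =>
    simp only [Term.eval]
    rw [fn_val _ _ _ _ _ fun h => absurd h ht.1]
    simp only [fun i => ih i (ht.2 i)]

theorem background_atom_eval {W : Type*} {Δ : W → S.Srt} (a : Atom S Δ)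
    (ha : a.IsBackground) (w : (x : W) → (restrictFg M c t₀).carrier (Δ x)) :
    a.Eval (restrictFg M c t₀) w ↔ a.Eval M fun x => (w x).1 := by
  cases a with
  | eq s t =>
    simp only [Atom.Eval, ← background_term_eval M c t₀ s ha.1 w,
      ← background_term_eval M c t₀ t ha.2 w]
    exact Subtype.ext_iff
  | rel R ts => simp only [Atom.Eval, ← fun i => background_term_eval M c t₀ (ts i) (ha i) w]; rfl
  | recRel R ts => exact ha.elim

open Classical in
theorem update_val (w : (x : S.Srt × ℕ) → (restrictFg M c t₀).carrier x.1) (p : S.Srt × ℕ)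
    (a : (restrictFg M c t₀).carrier p.1) :
    (fun x => (Function.update w p a x).1) =
      Function.update (β := fun x : S.Srt × ℕ => M.carrier x.1) (fun x => (w x).1) p a.1 := by
  funext x
  by_cases h : x = p
  · subst h; simp
  · simp [h]

theorem fo_eval (φ : FO S) (hφ : φ.IsBackground)
    (w : (x : S.Srt × ℕ) → (restrictFg M c t₀).carrier x.1) :
    φ.Eval (restrictFg M c t₀) w ↔ φ.Eval M fun x => (w x).1 := by
  induction φ generalizing w with
  | atom a => exact background_atom_eval M c t₀ a hφ w
  | fls => rfl
  | neg φ ih => simp only [FO.Eval, ih hφ]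
  | and φ ψ ih₁ ih₂ => simp only [FO.Eval, ih₁ hφ.1, ih₂ hφ.2]
  | or φ ψ ih₁ ih₂ => simp only [FO.Eval, ih₁ hφ.1, ih₂ hφ.2]
  | imp φ ψ ih₁ ih₂ => simp only [FO.Eval, ih₁ hφ.1, ih₂ hφ.2]
  | all σ n φ ih =>
    simp only [FO.Eval, ih hφ.2]
    constructor
    · intro h a
      exact (update_val M c t₀ w (σ, n) ⟨a, fun h => absurd h hφ.1⟩) ▸ h ⟨a, fun h => absurd h hφ.1⟩
    · intro h a
      rw [update_val]
      exact h a.1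
  | ex σ n φ ih =>
    simp only [FO.Eval, ih hφ.2]
    constructor
    · rintro ⟨a, h⟩
      rw [update_val] at h
      exact ⟨a.1, h⟩
    · rintro ⟨a, h⟩
      exact ⟨⟨a, fun h => absurd h hφ.1⟩,
        (update_val M c t₀ w (σ, n) ⟨a, fun h => absurd h hφ.1⟩).symm ▸ h⟩

theorem fo_holds {φ : FO S} (hφ : φ.IsBackground) (h : φ.Holds M) :
    φ.Holds (restrictFg M c t₀) :=
  fun w => (fo_eval M c t₀ φ hφ w).2 (h _)

end restrictFg

/-- Every foreground element is now named by a term, so each assignment of the variables of `φ` is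
one of its instances. -/
theorem restrictFg_univ_holds {n : ℕ} (M : Str S) (c : Fin n → M.carrier S.fg)
    (t₀ : Term S (S.fgCtx n) S.fg) (φ : Univ S)
    (h : ∀ t : Fin φ.n → Term S (S.fgCtx n) S.fg, (φ.body.subst t).Eval M c) :
    φ.Holds (restrictFg M (Γ := S.fgCtx n) c t₀) := by
  intro w
  choose t ht using fun i => (w i).2 rfl
  have := (restrictFg.qf_eval M (Γ := S.fgCtx n) c t₀ _).2 (h t)
  rw [QF.eval_subst] at this
  convert this using 2 with i
  exact Subtype.ext ((ht i).symm.trans (restrictFg.term_eval M (Γ := S.fgCtx n) c t₀ (t i)).symm)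

end Generated

/-! ### Herbrand's theorem modulo the background theory -/

namespace Problem

variable (P : Problem S)

theorem instances_mono {Φ Ψ : Set (Univ S)} (h : Φ ⊆ Ψ) {n k l : ℕ} (hkl : k ≤ l) :
    instances Φ n k ⊆ instances Ψ n l := by
  rintro _ ⟨φ, hφ, t, ht, rfl⟩
  exact ⟨φ, h hφ, t, fun i => (ht i).trans hkl, rfl⟩

/-- If a universal theory `Φ` together with a ground formula `χ` has models of its instances of
every depth, then `Φ ∪ {χ}` has a model. -/
theorem exists_model_of_forall_sat {n : ℕ} (t₀ : Term S (S.fgCtx n) S.fg) (Φ : Set (Univ S))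
    (χ : QF S (S.fgCtx n)) (h : ∀ k, P.Sat (instances Φ n k ∪ {χ})) :
    ∃ N : P.CModel n, (∀ φ ∈ Φ, φ.Holds N.M) ∧ χ.Eval N.M N.c := by
  choose N hN using h
  -- Non-principal, so any instance, having a finite depth, holds in almost all of the models.
  let U : Ultrafilter ℕ := Filter.hyperfilter ℕ
  let M := ultraproduct U fun k => (N k).M
  let c : Fin n → M.carrier S.fg := fun x => ultraproduct.mk U fun k => (N k).c x
  have hU : ∀ k, ∀ᶠ l in (U : Filter ℕ), k ≤ l := fun k =>
    Nat.hyperfilter_le_atTop (Filter.eventually_ge_atTop k)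
  have key : ∀ φ : QF S (S.fgCtx n), φ.Eval M c ↔
      ∀ᶠ k in (U : Filter ℕ), φ.Eval (N k).M (N k).c := fun φ =>
    ultraproduct.qf_eval U (Γ := S.fgCtx n) (fun x k => (N k).c x) φ
  refine ⟨⟨restrictFg M (Γ := S.fgCtx n) c t₀, fun τ hτ => ?_, restrictFg.assign M c t₀⟩,
    fun φ hφ => ?_, ?_⟩
  · exact restrictFg.fo_holds _ _ _ (P.theory_background τ hτ)
      (ultraproduct.fo_holds U fun k => (N k).theory_holds τ hτ)
  · refine restrictFg_univ_holds M c t₀ φ fun t => (key _).2 ?_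
    refine (hU (Finset.univ.sup fun i => (t i).depth)).mono fun k hk => ?_
    exact hN k _ (.inl ⟨φ, hφ, t, fun i =>
      (Finset.le_sup (f := fun i => (t i).depth) (Finset.mem_univ i)).trans hk, rfl⟩)
  · exact (restrictFg.qf_eval M (Γ := S.fgCtx n) c t₀ χ).2
      ((key χ).2 (.of_forall fun k => hN k _ (.inr rfl)))

theorem Sat.mono {P : Problem S} {n : ℕ} {Φ Ψ : Set (QF S (S.fgCtx n))} (h : Φ ⊆ Ψ)
    (hΨ : P.Sat Ψ) : P.Sat Φ :=
  let ⟨N, hN⟩ := hΨ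
  ⟨N, fun χ hχ => hN χ (h hχ)⟩

/-- The instances up to some depth refute the negation of a consequence. -/
theorem eventually_not_sat (φ : Univ S) (t₀ : Term S (S.fgCtx φ.n) S.fg) (Φ : Set (Univ S))
    (h : P.FOEntails Φ φ) :
    ∀ᶠ k in Filter.atTop, ¬ P.Sat (instances Φ φ.n k ∪ {.neg φ.body}) := by
  have : ∃ k, ¬ P.Sat (instances Φ φ.n k ∪ {.neg φ.body}) := by
    by_contra! hc
    obtain ⟨N, hN, hχ⟩ := P.exists_model_of_forall_sat t₀ Φ (.neg φ.body) hc
    exact hχ (h N.M N.theory_holds hN N.c)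
  obtain ⟨k, hk⟩ := this
  filter_upwards [Filter.eventually_ge_atTop k] with l hl hs
  exact hk (hs.mono (Set.union_subset_union_left _ (instances_mono subset_rfl hl)))

theorem models_instances {Φ : Set (Univ S)} {n : ℕ} (N : P.CModel n)
    (h : ∀ φ ∈ Φ, φ.Holds N.M) (k : ℕ) : N.Models (instances Φ n k) := by
  rintro _ ⟨φ, hφ, t, -, rfl⟩
  exact (QF.eval_subst _ _ _ _).2 (h φ hφ _)

/-- Unsatisfiability of instances is sound. -/
theorem foEntails_of_not_sat {Φ : Set (Univ S)} {φ : Univ S} {k : ℕ}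
    (h : ¬ P.Sat (instances Φ φ.n k ∪ {.neg φ.body})) : P.FOEntails Φ φ := by
  intro M hT hΦ w
  by_contra hw
  refine h ⟨⟨M, hT, w⟩, ?_⟩
  rintro χ (hχ | rfl)
  · exact P.models_instances ⟨M, hT, w⟩ hΦ k χ hχ
  · exact hw

end Problem

/-! ### Induction by prefixed points -/

/-- Interpretations of the recursively defined relations. -/
abbrev Str.RecInterp (M : Str S) : Type u :=
  (R : S.RecRel) → (Fin (S.recArity R) → M.carrier S.fg) → Prop

theorem Term.eval_withRec (M : Str S) (I : M.RecInterp) (w : (x : V) → M.carrier (Γ x))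
    {σ : S.Srt} (t : Term S Γ σ) : t.eval (M.withRec I) w = t.eval M w := by
  induction t with
  | var x => rfl
  | app f ts ih => simp only [Term.eval, ih]; rfl

/-- Negation and the left side of an implication flip the polarity, so both directions are proved
together. -/
theorem QF.eval_withRec_mono (M : Str S) {I J : M.RecInterp} (h : I ≤ J)
    (w : (x : V) → M.carrier (Γ x)) (φ : QF S Γ) :
    (φ.RecPolarity true → φ.Eval (M.withRec I) w → φ.Eval (M.withRec J) w) ∧
    (φ.RecPolarity false → φ.Eval (M.withRec J) w → φ.Eval (M.withRec I) w) := by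
  induction φ with
  | atom a =>
    cases a with
    | eq s t =>
      simp only [QF.Eval, Atom.Eval, Term.eval_withRec]
      exact ⟨fun _ h => h, fun _ h => h⟩
    | rel R ts =>
      simp only [QF.Eval, Atom.Eval, Term.eval_withRec]
      exact ⟨fun _ h => h, fun _ h => h⟩
    | recRel R ts =>
      simp only [QF.Eval, Atom.Eval, Term.eval_withRec]
      exact ⟨fun _ => h R _, fun h' => absurd h' (by simp [QF.RecPolarity])⟩
  | fls => exact ⟨fun _ h => h, fun _ h => h⟩
  | neg φ ih => exact ⟨fun p => mt (ih.2 p), fun p => mt (ih.1 p)⟩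
  | and φ ψ ih₁ ih₂ =>
    exact ⟨fun p => And.imp (ih₁.1 p.1) (ih₂.1 p.2), fun p => And.imp (ih₁.2 p.1) (ih₂.2 p.2)⟩
  | or φ ψ ih₁ ih₂ =>
    exact ⟨fun p => Or.imp (ih₁.1 p.1) (ih₂.1 p.2), fun p => Or.imp (ih₁.2 p.1) (ih₂.2 p.2)⟩
  | imp φ ψ ih₁ ih₂ =>
    exact ⟨fun p h hφ => ih₂.1 p.2 (h (ih₁.2 p.1 hφ)),
      fun p h hφ => ih₂.2 p.2 (h (ih₁.1 p.1 hφ))⟩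

theorem RecDefs.op_mono (D : RecDefs S) (M : Str S) : Monotone (D.op M) :=
  fun _ _ h R w => (QF.eval_withRec_mono M h w (D.body R)).1 (D.pos R)

theorem RecDefs.IsLFP.op_recRel {D : RecDefs S} {M : Str S} (h : D.IsLFP M) :
    D.op M M.recRel = M.recRel :=
  h.1

/-- The least fixpoint is below every prefixed point. -/
theorem RecDefs.IsLFP.le {D : RecDefs S} {M : Str S} (h : D.IsLFP M) {I : M.RecInterp}
    (hI : D.op M I ≤ I) : M.recRel ≤ I := by
  let f : M.RecInterp →o M.RecInterp := ⟨D.op M, D.op_mono M⟩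
  -- Knaster–Tarski: least fixpoint and least prefixed point of a monotone operator coincide.
  have : M.recRel = OrderHom.lfp f := h.unique f.isLeast_lfp
  exact this ▸ f.lfp_le hI

theorem RecDefs.IsLFP.holds {D : RecDefs S} {M : Str S} (h : D.IsLFP M) :
    ∀ χ ∈ D.toUniv, χ.Holds M := by
  rintro _ ⟨R, rfl⟩ w
  have : (D.body R).Eval M w ↔ M.recRel R w := iff_of_eq (congrFun (congrFun h.op_recRel R) w)
  exact ⟨this.2, this.1⟩

/-- The interpretation in which `R` is strengthened by `ψ`. -/
def Str.strengthenRec (M : Str S) (R : S.RecRel) (ψ : QF S (S.fgCtx (S.recArity R))) :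
    M.RecInterp :=
  fun Q w => M.recRel Q w ∧ ∀ h : R = Q,
    ψ.Eval M fun i => w (Fin.cast (congrArg S.recArity h) i)

/-- Turns the syntactic replacement in `PFP` into a change of interpretation, to which the fixpoint
operator can be applied. -/
theorem QF.eval_strengthen (M : Str S) (R : S.RecRel) (ψ : QF S (S.fgCtx (S.recArity R)))
    (w : (x : V) → M.carrier (Γ x)) (φ : QF S Γ) :
    (QF.strengthen R ψ φ).Eval M w ↔ φ.Eval (M.withRec (M.strengthenRec R ψ)) w := by
  induction φ with
  | atom a =>
    cases a with
    | eq s t => simp only [QF.strengthen, QF.Eval, Atom.Eval, Term.eval_withRec]; rfl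
    | rel Q ts => simp only [QF.strengthen, QF.Eval, Atom.Eval, Term.eval_withRec]; rfl
    | recRel Q ts =>
      simp only [QF.strengthen, QF.Eval, Atom.Eval, Term.eval_withRec]
      by_cases h : Q = R
      · subst h
        simp only [dite_true, QF.Eval, Atom.Eval, QF.eval_subst]
        exact ⟨fun h => ⟨h.2, fun _ => h.1⟩, fun h => ⟨h.2 rfl, h.1⟩⟩
      · simp only [h, dite_false, QF.Eval, Atom.Eval]
        exact ⟨fun h' => ⟨h', fun h'' => absurd h''.symm h⟩, fun h => h.1⟩
  | fls => rfl
  | neg φ ih => simp only [QF.strengthen, QF.Eval, ih]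
  | and φ ψ ih₁ ih₂ => simp only [QF.strengthen, QF.Eval, ih₁, ih₂]
  | or φ ψ ih₁ ih₂ => simp only [QF.strengthen, QF.Eval, ih₁, ih₂]
  | imp φ ψ ih₁ ih₂ => simp only [QF.strengthen, QF.Eval, ih₁, ih₂]

/-- Soundness of induction: in the least fixpoint, `PFP(L)` implies `L`. -/
theorem RecDefs.IsLFP.holds_of_pfp {D : RecDefs S} {M : Str S} (h : D.IsLFP M)
    {L : IndLemma S} (hL : (L.pfp D).Holds M) : L.toUniv.Holds M := by
  have hle : M.recRel ≤ M.strengthenRec L.R L.ψ := by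
    refine h.le fun Q w hw => ⟨?_, ?_⟩
    -- Lying below the fixpoint gives the first conjunct by monotonicity; the second is exactly
    -- `PFP(L)`.
    · have := D.op_mono M (show M.strengthenRec L.R L.ψ ≤ M.recRel from fun _ _ h => h.1) Q w hw
      rwa [h.op_recRel] at this
    · rintro rfl
      exact hL w ((QF.eval_strengthen M _ _ _ _).2 hw)
  exact fun w hw => (hle L.R w hw).2 rfl

namespace Problem

variable {P : Problem S}

theorem IsLFPModel.holds_withLemmas {M : Str S} (hM : P.IsLFPModel M) {𝓛 : Set (IndLemma S)}
    (h𝓛 : ∀ L ∈ 𝓛, P.LFPEntails L.toUniv) : ∀ χ ∈ P.withLemmas 𝓛, χ.Holds M := by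
  rintro _ ((h | h) | ⟨L, hL, rfl⟩)
  · exact hM.2.1 _ h
  · exact hM.2.2.holds _ h
  · exact h𝓛 L hL M hM

/-- A lemma that is inductive relative to valid lemmas is valid. -/
theorem lfpEntails_of_pfp {𝓛 : Set (IndLemma S)} (h𝓛 : ∀ L ∈ 𝓛, P.LFPEntails L.toUniv)
    {L : IndLemma S} (hL : P.FOEntails (P.withLemmas 𝓛) (L.pfp P.D)) :
    P.LFPEntails L.toUniv :=
  fun M hM => hM.2.2.holds_of_pfp (hL M hM.1 (hM.holds_withLemmas h𝓛))

theorem withLemmas_empty : P.withLemmas ∅ = P.A ∪ P.D.toUniv := by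
  simp [withLemmas]

theorem withLemmas_mono {𝓛 𝓛' : Set (IndLemma S)} (h : 𝓛 ⊆ 𝓛') :
    P.withLemmas 𝓛 ⊆ P.withLemmas 𝓛' :=
  Set.union_subset_union_right _ (Set.image_mono h)

theorem exists_term (hground : Nonempty (Term S (S.fgCtx 0) S.fg) ∨
      (0 < P.α.n ∧ ∀ R : S.RecRel, 0 < S.recArity R)) :
    Nonempty (Term S (S.fgCtx P.α.n) S.fg) ∧
      ∀ R : S.RecRel, Nonempty (Term S (S.fgCtx (S.recArity R)) S.fg) := by
  obtain ⟨⟨t⟩⟩ | ⟨h, h'⟩ := hground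
  · exact ⟨⟨t.subst fun i => i.elim0⟩, fun R => ⟨t.subst fun i => i.elim0⟩⟩
  · exact ⟨⟨.var (Γ := S.fgCtx _) ⟨0, h⟩⟩, fun R => ⟨.var (Γ := S.fgCtx _) ⟨0, h' R⟩⟩⟩

/-- A depth at which the instances show that `𝓛₀` implies `α` and that all lemmas in `𝓛₀` are
inductive. -/
structure SufficientDepth (P : Problem S) (𝓛₀ : Set (IndLemma S)) (k : ℕ) : Prop where
  goal : ¬ P.Sat (P.goalInstances k 𝓛₀)
  pfp : ∀ L ∈ 𝓛₀, ¬ P.Sat (P.pfpInstances k ∅ L)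

/-- Each refutation persists at larger depths, and there are finitely many of them. -/
theorem exists_sufficientDepth (hground : Nonempty (Term S (S.fgCtx 0) S.fg) ∨
      (0 < P.α.n ∧ ∀ R : S.RecRel, 0 < S.recArity R)) {𝓛₀ : Set (IndLemma S)}
    (hfin : 𝓛₀.Finite) (hind : ∀ L ∈ 𝓛₀, P.Inductive L)
    (hα : P.FOEntails (P.withLemmas 𝓛₀) P.α) : ∃ k, P.SufficientDepth 𝓛₀ k := by
  obtain ⟨⟨t⟩, ht⟩ := exists_term hground
  have h₁ := P.eventually_not_sat P.α t _ hα
  have h₂ := (Filter.eventually_all_finite hfin).2 fun L hL =>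
    P.eventually_not_sat (L.pfp P.D) (ht L.R).some (P.withLemmas ∅)
      (by rw [withLemmas_empty]; exact hind L hL)
  obtain ⟨k, hk₁, hk₂⟩ := (h₁.and h₂).exists
  exact ⟨k, hk₁, hk₂⟩

/-! ### Runs of the algorithm -/

/-- The invariant of the algorithm. -/
def Invariant (P : Problem S) (k : ℕ) : P.State → Prop
  | .outer 𝓛 𝓜 => 𝓛.Finite ∧ (∀ L ∈ 𝓛, P.LFPEntails L.toUniv) ∧ ∀ R, 𝓜 R = ∅
  | .inner 𝓛 M 𝓜 => 𝓛.Finite ∧ (∀ L ∈ 𝓛, P.LFPEntails L.toUniv) ∧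
      M.Models (P.goalInstances k 𝓛) ∧
      ∀ R, ∀ N ∈ 𝓜 R, N.Models (instances (P.withLemmas 𝓛) (S.recArity R) k)
  | .output 𝓛 => 𝓛.Finite ∧ P.Proves 𝓛
  | .noProofFound => False

variable {𝓛₀ : Set (IndLemma S)} {k : ℕ} {𝒢 : Set (Str S)}

theorem lfpEntails_of_mem (hk : P.SufficientDepth 𝓛₀ k) {L : IndLemma S} (hL : L ∈ 𝓛₀) :
    P.LFPEntails L.toUniv :=
  lfpEntails_of_pfp (𝓛 := ∅) (by simp) (P.foEntails_of_not_sat (hk.pfp L hL))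

theorem exists_candidate (hk : P.SufficientDepth 𝓛₀ k) (h𝒢 : ∀ G ∈ 𝒢, P.IsLFPModel G)
    {𝓛 M 𝓜} (h : P.Invariant k (.inner 𝓛 M 𝓜)) :
    ∃ L ∈ 𝓛₀, P.Candidate 𝒢 k M 𝓜 L := by
  obtain ⟨-, -, hM, h𝓜⟩ := h
  by_contra! hc
  refine hk.goal ⟨M, ?_⟩
  rintro χ (⟨φ, hφ | ⟨L, hL, rfl⟩, t, ht, rfl⟩ | rfl)
  · exact hM _ (.inl ⟨φ, .inl hφ, t, ht, rfl⟩)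
  · by_contra hχ
    refine hc L hL ⟨⟨fun i => (t i).eval M.M M.c, fun i => ⟨t i, ht i, rfl⟩, ?_⟩, fun N hN => ?_,
      fun G hG => lfpEntails_of_mem hk hL G (h𝒢 G hG)⟩
    · rwa [QF.eval_subst] at hχ
    · by_contra hN'
      refine hk.pfp L hL ⟨N, ?_⟩
      rintro χ (hχ | rfl)
      -- Inductiveness was tested without lemmas; `N` satisfies even the instances that include the
      -- learned ones.
      · exact h𝓜 _ N hN χ (instances_mono (withLemmas_mono (Set.empty_subset _)) le_rfl hχ)
      · exact hN'
  · exact hM _ (.inr rfl)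

/-- The current model satisfies all depth-`k` instances of learned lemmas, whereas a candidate fails
on one. -/
theorem Candidate.notMem {M : P.CModel P.α.n} {𝓜} {L : IndLemma S} (h : P.Candidate 𝒢 k M 𝓜 L)
    {𝓛} (hM : M.Models (P.goalInstances k 𝓛)) : L ∉ 𝓛 := by
  intro hL
  obtain ⟨w, hw, hw'⟩ := h.false_on_terms
  choose t ht htw using hw
  have := (QF.eval_subst _ _ _ _).1 (hM _ (.inl ⟨L.toUniv, .inr ⟨L, hL, rfl⟩, t, ht, rfl⟩))
  obtain rfl : (fun i => (t i).eval M.M M.c) = w := funext htw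
  exact hw' this

open Classical in
theorem Invariant.step (hk : P.SufficientDepth 𝓛₀ k) (h𝒢 : ∀ G ∈ 𝒢, P.IsLFPModel G)
    {sel : P.Selector 𝒢 k} {s s' : P.State} (h : P.Step sel s s') (hs : P.Invariant k s) :
    P.Invariant k s' := by
  cases h with
  | enter M hM => exact ⟨hs.1, hs.2.1, hM, fun R N hN => by simp [hs.2.2 R] at hN⟩
  | exit h => exact ⟨hs.1, P.foEntails_of_not_sat h, hs.2.1⟩
  | stuck h => exact h ((exists_candidate hk h𝒢 hs).imp fun _ h => h.2)
  | @refute 𝓛 M 𝓜 L hL N hN =>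
    refine ⟨hs.1, hs.2.1, hs.2.2.1, fun R N' hN' => ?_⟩
    by_cases hR : R = L.R
    · subst hR
      rw [Function.update_self] at hN'
      obtain rfl | hN' := hN'
      · exact fun χ hχ => hN χ (.inl hχ)
      · exact hs.2.2.2 _ N' hN'
    · rw [Function.update_of_ne hR] at hN'
      exact hs.2.2.2 _ N' hN'
  | learn L hL h =>
    refine ⟨hs.1.insert _, ?_, fun _ => rfl⟩
    rintro L' (rfl | hL')
    · exact lfpEntails_of_pfp hs.2.1 (P.foEntails_of_not_sat h)
    · exact hs.2.1 L' hL'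

theorem invariant_init : P.Invariant k P.init :=
  ⟨Set.finite_empty, by simp, fun _ => rfl⟩

theorem exists_step (hk : P.SufficientDepth 𝓛₀ k) (h𝒢 : ∀ G ∈ 𝒢, P.IsLFPModel G)
    (sel : P.Selector 𝒢 k) {s : P.State} (hs : P.Invariant k s) (hout : ∀ 𝓛, s ≠ .output 𝓛) :
    ∃ s', P.Step sel s s' := by
  cases s with
  | outer 𝓛 𝓜 =>
    by_cases h : P.Sat (P.goalInstances k 𝓛)
    · obtain ⟨M, hM⟩ := h
      exact ⟨_, .enter M hM⟩
    · exact ⟨_, .exit h⟩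
  | inner 𝓛 M 𝓜 =>
    obtain ⟨L, hL⟩ := sel.total 𝓛 M 𝓜 ((exists_candidate hk h𝒢 hs).imp fun _ h => h.2)
    by_cases h : P.Sat (P.pfpInstances k 𝓛 L)
    · obtain ⟨N, hN⟩ := h
      exact ⟨_, .refute L hL N hN⟩
    · exact ⟨_, .learn L hL h⟩
  | output 𝓛 => exact absurd rfl (hout 𝓛)
  | noProofFound => exact hs.elim

/-! ### Termination -/

/-- The union of `before` over the finite set `𝓛₀`, with `𝓛₀` itself, does not depend on the state.
-/
theorem Selector.Fair.exists_finite {sel : P.Selector 𝒢 k} (hfair : sel.Fair)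
    (hfin : 𝓛₀.Finite) : ∃ F : Set (IndLemma S), F.Finite ∧ ∀ 𝓛 M 𝓜 L L', L ∈ 𝓛₀ →
      P.Candidate 𝒢 k M 𝓜 L → sel.picks 𝓛 M 𝓜 L' → L' ∈ F := by
  obtain ⟨before, hb, h⟩ := hfair
  refine ⟨⋃ L ∈ 𝓛₀, insert L (before L), hfin.biUnion fun L _ => (hb L).insert L, ?_⟩
  intro 𝓛 M 𝓜 L L' hL hc hp
  exact Set.mem_biUnion hL (h 𝓛 M 𝓜 L L' hc hp)

/-- The lemmas in `F` whose induction step is true in the current models. -/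
def liveLemmas (P : Problem S) (F : Set (IndLemma S))
    (𝓜 : (R : S.RecRel) → Set (P.CModel (S.recArity R))) : Set (IndLemma S) :=
  {L ∈ F | ∀ N ∈ 𝓜 L.R, (L.pfp P.D).body.Eval N.M N.c}

/-- The termination measure: the lemmas that remain to be learned, the lemmas that are not yet
refuted, and the control state. -/
noncomputable def measure (P : Problem S) (F : Set (IndLemma S)) : P.State → ℕ ×ₗ ℕ ×ₗ ℕ
  -- The last entry only has to drop on entering the inner loop and on output. Learning may revive
  -- refuted lemmas, so the count of lemmas still to be learned comes first.
  | .outer 𝓛 𝓜 => toLex ((F \ 𝓛).ncard, toLex ((P.liveLemmas F 𝓜).ncard, 2))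
  | .inner 𝓛 _ 𝓜 => toLex ((F \ 𝓛).ncard, toLex ((P.liveLemmas F 𝓜).ncard, 1))
  | .output 𝓛 => toLex ((F \ 𝓛).ncard, toLex (0, 0))
  | .noProofFound => toLex (0, toLex (0, 0))

open Classical in
theorem measure_lt (hk : P.SufficientDepth 𝓛₀ k) (h𝒢 : ∀ G ∈ 𝒢, P.IsLFPModel G)
    {sel : P.Selector 𝒢 k} {F : Set (IndLemma S)} (hF : F.Finite)
    (hsel : ∀ 𝓛 M 𝓜 L L', L ∈ 𝓛₀ → P.Candidate 𝒢 k M 𝓜 L → sel.picks 𝓛 M 𝓜 L' → L' ∈ F)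
    {s s' : P.State} (h : P.Step sel s s') (hs : P.Invariant k s) :
    P.measure F s' < P.measure F s := by
  cases h with
  | enter M hM => simp [measure, Prod.Lex.toLex_lt_toLex]
  | exit h =>
    -- If no lemma is live, the second entry is already 0 and the control entry decides.
    simp only [measure, Prod.Lex.toLex_lt_toLex, lt_self_iff_false, false_or, true_and]
    omega
  | stuck h => exact absurd ((exists_candidate hk h𝒢 hs).imp fun _ h => h.2) h
  | @refute 𝓛 M 𝓜 L hL N hN =>
    obtain ⟨L₁, hL₁, hc⟩ := exists_candidate hk h𝒢 hs
    have hLF := hsel _ _ _ _ _ hL₁ hc hL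
    have hlt : (P.liveLemmas F (Function.update 𝓜 L.R (insert N (𝓜 L.R)))).ncard <
        (P.liveLemmas F 𝓜).ncard := by
      refine Set.ncard_lt_ncard ⟨?_, fun hsub => ?_⟩ (hF.subset fun _ h => h.1)
      · rintro L' ⟨hL', h⟩
        refine ⟨hL', fun N' hN' => h N' ?_⟩
        by_cases hR : L'.R = L.R
        · obtain ⟨R, ψ⟩ := L'
          subst hR
          rw [Function.update_self]
          exact .inr hN'
        · rwa [Function.update_of_ne hR]
      -- The selected lemma was live, being a candidate, and the new model `N` falsifies its
      -- induction step.
      · have := (hsub ⟨hLF, (sel.sound _ _ _ _ hL).pfp_true⟩).2 N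
        rw [Function.update_self] at this
        exact hN _ (.inr rfl) (this (.inl rfl))
    exact Prod.Lex.toLex_lt_toLex.2 (.inr ⟨rfl, Prod.Lex.toLex_lt_toLex.2 (.inl hlt)⟩)
  | @learn 𝓛 M 𝓜 L hL h =>
    obtain ⟨L₁, hL₁, hc⟩ := exists_candidate hk h𝒢 hs
    have hLF := hsel _ _ _ _ _ hL₁ hc hL
    have hlt : (F \ insert L 𝓛).ncard < (F \ 𝓛).ncard := by
      refine Set.ncard_lt_ncard ⟨Set.sdiff_subset_sdiff_right (Set.subset_insert _ _),
        fun hsub => ?_⟩ hF.sdiff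
      exact (hsub ⟨hLF, (sel.sound _ _ _ _ hL).notMem hs.2.2.1⟩).2 (.inl rfl)
    exact Prod.Lex.toLex_lt_toLex.2 (.inl hlt)

end Problem

end LemmaSynthesis

/-! ### Termination and correctness of all runs -/

theorem mainTheorem1 (S : Sig.{u}) (P : Problem S)
    (hground : Nonempty (Term S (S.fgCtx 0) S.fg) ∨
      (0 < P.α.n ∧ ∀ R : S.RecRel, 0 < S.recArity R))
    (hprov : ∃ 𝓛₀ : Set (IndLemma S), 𝓛₀.Finite ∧ (∀ L ∈ 𝓛₀, P.Inductive L) ∧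
      P.FOEntails (P.withLemmas 𝓛₀) P.α) :
    ∃ k : ℕ, ∀ 𝒢 : Set (Str S), (∀ G ∈ 𝒢, P.IsLFPModel G) →
      ∀ sel : P.Selector 𝒢 k, sel.Fair →
        (¬ ∃ s : ℕ → P.State, s 0 = P.init ∧ ∀ i, P.Step sel (s i) (s (i + 1))) ∧
        ∀ s : P.State, Relation.ReflTransGen (P.Step sel) P.init s →
          (∀ s', ¬ P.Step sel s s') →
          ∃ 𝓛 : Set (IndLemma S), s = .output 𝓛 ∧ 𝓛.Finite ∧ P.Proves 𝓛 := by
  obtain ⟨𝓛₀, hfin, hind, hα⟩ := hprov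
  obtain ⟨k, hk⟩ := Problem.exists_sufficientDepth hground hfin hind hα
  refine ⟨k, fun 𝒢 h𝒢 sel hfair => ⟨?_, fun s hs hterm => ?_⟩⟩
  · rintro ⟨s, h₀, hstep⟩
    obtain ⟨F, hF, hsel⟩ := hfair.exists_finite hfin
    have hinv : ∀ i, P.Invariant k (s i) := by
      intro i
      induction i with
      | zero => exact h₀ ▸ Problem.invariant_init
      | succ i ih => exact Problem.Invariant.step hk h𝒢 (hstep i) ih
    exact not_strictAnti_of_wellFoundedLT (fun i => P.measure F (s i))
      (strictAnti_nat_of_succ_lt fun i =>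
        Problem.measure_lt hk h𝒢 hF hsel (hstep i) (hinv i))
  · have hinv : P.Invariant k s := by
      clear hterm
      induction hs with
      | refl => exact Problem.invariant_init
      | tail _ h ih => exact Problem.Invariant.step hk h𝒢 h ih
    by_cases hout : ∃ 𝓛, s = .output 𝓛
    · obtain ⟨𝓛, rfl⟩ := hout
      exact ⟨𝓛, rfl, hinv⟩
    · obtain ⟨s', hs'⟩ := Problem.exists_step hk h𝒢 sel hinv (not_exists.1 hout)
      exact absurd hs' (hterm s')
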